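/- Let $X$ be a reflexive real Banach space whose norm is Fréchet differentiable at every nonzero point and such that both $X$ and its dual $X^*$ are locally uniformly convex. Notation: for $x\in X$, $$J(x)=\{x^*\in X^*:\ \langle x^*,x\rangle=\|x\|^2=\|x^*\|^2\};$$ for $\Omega\subset X$ and $x\in\Omega$, $T(x,\Omega)$ is the set of $v\in X$ for which there are $t_k>0$, $t_k\to0$, and $v_k\to v$ with $x+t_kv_k\in\Omega$ for all $k$, and $J(T(x,\Omega))=\bigcup_{v\in T(x,\Omega)}J(v)$. The product $X\times\mathbb R$ carries the norm $\|(x,r)\|=\|x\|+|r|$. For $f:X\to[-\infty,\infty]$ let $f_\Omega=f$ on $\Omega$, $f_\Omega=\infty$ off $\Omega$, and $\operatorname{epi}f_\Omega=\{(u,r)\in X\times\mathbb R:\ f_\Omega(u)\le r\}$. If $x\in\Omega$ and $f(x)$ is finite, the $\epsilon$-regular subdifferential of $f$ at $x$ relative to $\Omega$ ($\epsilon\ge0$) is $$\widehat\partial^{\epsilon}_{\Omega}f(x)=\Big\{x^*\in J(T(x,\Omega)):\ \limsup_{(u,r)\to(x,f(x)),\ (u,r)\in \operatorname{epi}f_\Omega\setminus\{(x,f(x))\}}\frac{\langle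 x^*,u-x\rangle-(r-f(x))}{\|(u,r)-(x,f(x))\|}\le\epsilon\Big\},$$ and the limiting subdifferential $\partial_\Omega f(x)$ of $f$ at $x$ relative to $\Omega$ is the set of all $x^*\in X^*$ for which there are $\epsilon_k\downarrow0$ (nonincreasing, positive), $x_k\in\Omega$ with $x_k\to x$ and $f(x_k)\to f(x)$, and $x_k^*\in\widehat\partial^{\epsilon_k}_\Omega f(x_k)$ with $x_k^*\to x^*$ weakly*. Both sets are empty if $x\notin\Omega$ or $f(x)=\pm\infty$. **Theorem.** Let $C\subset X$ be closed and convex, let $\bar x\in C$, let $\ell\ge0$, and let $f_1,f_2:X\to[-\infty,\infty]$ be such that * $f_1$ is locally Lipschitz relative to $C$ around $\bar x$ with modulus $\ell$: there is a neighborhood $U$ of $\bar x$ such that $f_1$ is finite on $U\cap C$ and $|f_1(x)-f_1(u)|\le\ell\|x-u\|$ for all $x,u\in U\cap C$; * $f_2$ is lower semicontinuous relative to $C$ around $\bar x$: there is a neighborhood $V$ of $\bar x$ such that $\liminf_{u\to x,\,u\in C}f_2(u)\ge f_2(x)$ for all $x\in V\cap C$; and $f_2(\bar x)$ is finite; * $\bar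 x$ is a local minimizer of $f_1+f_2$ over $C$. Then there is $\eta_0>0$ such that for every $\eta\in(0,\eta_0)$ there exist $x_1,x_2\in C$ with $\|x_i-\bar x\|\le\eta$, $f_i(x_i)$ finite and $|f_i(x_i)-f_i(\bar x)|\le\eta$ $(i=1,2)$, and some $\tilde\eta\in(0,4\eta(\ell+1))$, such that $$0\in\widehat\partial^{\tilde\eta}_{C}f_1(x_1)+\widehat\partial^{\tilde\eta}_{C}f_2(x_2).$$ Moreover, $$0\in\partial_Cf_1(\bar x)+\partial_Cf_2(\bar x).$$ -/

import Mathlib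

open Filter Topology
open scoped Pointwise

/-- `X` is reflexive: the canonical embedding into the bidual is onto. -/
def IsReflexiveSpace (X : Type*) [NormedAddCommGroup X] [NormedSpace ℝ X] : Prop :=
  Function.Surjective (NormedSpace.inclusionInDoubleDual ℝ X)

/-- Local uniform convexity (local uniform rotundity) of the norm of `X`. -/
def IsLocallyUniformlyConvex (X : Type*) [NormedAddCommGroup X] : Prop :=
  ∀ x : X, ‖x‖ = 1 → ∀ ε : ℝ, 0 < ε → ∃ δ : ℝ, 0 < δ ∧
    ∀ y : X, ‖y‖ = 1 → ε ≤ ‖x - y‖ → ‖x + y‖ ≤ 2 - δ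

/-- The (set-valued) duality mapping `J : X ⇉ X*`. -/
def dualityMap {X : Type*} [NormedAddCommGroup X] [NormedSpace ℝ X] (x : X) :
    Set (StrongDual ℝ X) :=
  {xs | xs x = ‖x‖ ^ 2 ∧ ‖xs‖ ^ 2 = ‖x‖ ^ 2}

/-- The (Bouligand) tangent cone `T(x, Ω)`: limits of `v k` with `x + t k • v k ∈ Ω`, `t k → 0⁺`.
(Mathlib's `tangentConeAt ℝ` is the two-sided version of this cone.) -/
def bouligandCone {X : Type*} [NormedAddCommGroup X] [NormedSpace ℝ X] (x : X) (Ω : Set X) :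
    Set X :=
  {v | ∃ (t : ℕ → ℝ) (w : ℕ → X), (∀ k, 0 < t k) ∧ Tendsto t atTop (𝓝 0) ∧
    Tendsto w atTop (𝓝 v) ∧ ∀ k, x + t k • w k ∈ Ω}

/-- The image `J(T(x, Ω))`. -/
def dualTangent {X : Type*} [NormedAddCommGroup X] [NormedSpace ℝ X] (x : X) (Ω : Set X) :
    Set (StrongDual ℝ X) :=
  ⋃ v ∈ bouligandCone x Ω, dualityMap v

/-- The set of `ε`-normals at `z` to a subset `S` of `X × ℝ`, as a set of pairs `(x*, y*)`, which act
by `⟨(x*, y*), (u, r)⟩ = x* u + y* r`. The product carries the sum norm `‖(u, r)‖ = ‖u‖ + |r|`, which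
is written out. The upper limit runs over `w → z` with `w ∈ S`, `w ≠ z`, and is taken in `[-∞, ∞]`
(so that it is `-∞` if `z` is isolated in `S`). -/
def epsNormal {X : Type*} [NormedAddCommGroup X] [NormedSpace ℝ X] (ε : ℝ) (z : X × ℝ)
    (S : Set (X × ℝ)) : Set (StrongDual ℝ X × ℝ) :=
  {p | limsup (fun w : X × ℝ =>
      (((p.1 (w.1 - z.1) + p.2 * (w.2 - z.2)) / (‖w.1 - z.1‖ + |w.2 - z.2|) : ℝ) : EReal))
      (𝓝[S \ {z}] z) ≤ (ε : EReal)}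

/-- The epigraph of `f : X → [-∞, ∞]`, a subset of `X × ℝ`. -/
def epigraph {X : Type*} (f : X → EReal) : Set (X × ℝ) :=
  {w | f w.1 ≤ (w.2 : EReal)}

open Classical in
/-- `f_Ω`: equal to `f` on `Ω` and to `∞` elsewhere. -/
noncomputable def restrictTo {X : Type*} (f : X → EReal) (Ω : Set X) (x : X) : EReal :=
  if x ∈ Ω then f x else ⊤

/-- `f` is finite at `x`. -/
def FiniteAt {X : Type*} (f : X → EReal) (x : X) : Prop :=
  f x ≠ ⊤ ∧ f x ≠ ⊥

/-- The geometric `ε`-subdifferential of `f` at `x` (empty unless `f` is finite at `x`). -/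
def geomSubdiff {X : Type*} [NormedAddCommGroup X] [NormedSpace ℝ X] (ε : ℝ) (f : X → EReal)
    (x : X) : Set (StrongDual ℝ X) :=
  {xs | FiniteAt f x ∧ (xs, (-1 : ℝ)) ∈ epsNormal ε (x, (f x).toReal) (epigraph f)}

/-- The `ε`-regular subdifferential of `f` at `x` relative to `Ω`
(empty unless `x ∈ Ω` and `f` is finite at `x`). -/
def relRegSubdiff {X : Type*} [NormedAddCommGroup X] [NormedSpace ℝ X] (ε : ℝ) (Ω : Set X)
    (f : X → EReal) (x : X) : Set (StrongDual ℝ X) :=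
  {xs | x ∈ Ω ∧ FiniteAt f x ∧ xs ∈ geomSubdiff ε (restrictTo f Ω) x ∩ dualTangent x Ω}

/-- The limiting subdifferential of `f` at `x` relative to `Ω`
(empty unless `x ∈ Ω` and `f` is finite at `x`). The convergence `ys k → xs` is weak*. -/
def relLimSubdiff {X : Type*} [NormedAddCommGroup X] [NormedSpace ℝ X] (Ω : Set X)
    (f : X → EReal) (x : X) : Set (StrongDual ℝ X) :=
  {xs | x ∈ Ω ∧ FiniteAt f x ∧
    ∃ (ε : ℕ → ℝ) (y : ℕ → X) (ys : ℕ → StrongDual ℝ X),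
      Antitone ε ∧ (∀ k, 0 < ε k) ∧ Tendsto ε atTop (𝓝 0) ∧
      (∀ k, y k ∈ Ω) ∧ Tendsto y atTop (𝓝 x) ∧ Tendsto (fun k => f (y k)) atTop (𝓝 (f x)) ∧
      (∀ v : X, Tendsto (fun k => ys k v) atTop (𝓝 (xs v))) ∧
      ∀ k, ys k ∈ relRegSubdiff (ε k) Ω f (y k)}

/-- `f` is locally Lipschitz relative to `Ω` around `x` with modulus `ℓ`; in particular `f` is finite
at the points of `Ω` near `x`. -/
def LocLipschitzRel {X : Type*} [NormedAddCommGroup X] (f : X → EReal) (Ω : Set X) (x : X)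
    (ℓ : ℝ) : Prop :=
  ∃ U ∈ 𝓝 x, (∀ u ∈ U ∩ Ω, FiniteAt f u) ∧
    ∀ u ∈ U ∩ Ω, ∀ v ∈ U ∩ Ω, |(f u).toReal - (f v).toReal| ≤ ℓ * ‖u - v‖

/-- `f` is lower semicontinuous relative to `Ω` around `x`. -/
def LscRelAround {X : Type*} [NormedAddCommGroup X] (f : X → EReal) (Ω : Set X) (x : X) : Prop :=
  ∃ U ∈ 𝓝 x, ∀ u ∈ U ∩ Ω, LowerSemicontinuousWithinAt f Ω u

/-!
The two functions are decoupled by a quadratic penalty: `f₁ x + f₂ u + k * ‖x - u‖ ^ 2 / 2` is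
almost minimized over `C × C` near `(x̄, x̄)`, and Ekeland's principle turns the almost minimizer
`(x̄, x̄)` into a nearby pair `(x₁, x₂)` that is an exact minimizer up to a small multiple of the
distance (`exists_penalized_almost_minimizer`). Minimality in each variable separately says that
`-k J(x₁ - x₂)` and `k J(x₁ - x₂)` are `η`-regular subgradients of `f₁` at `x₁` and of `f₂` at `x₂`
(`mem_relRegSubdiff_of_hasFDerivAt`), the distance term being absorbed by the tolerance `η`. Here
`J(v)` is the derivative of `‖·‖ ^ 2 / 2` at `v`. The condition that subgradients lie in
`J(T(xᵢ, C))` comes for free: `-k J(x₁ - x₂) = J(k (x₂ - x₁))`, and `k (x₂ - x₁)` is a tangent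
direction at `x₁` because `C` is convex; likewise at `x₂`.

For the limiting statement, the Lipschitz bound on `f₁` along the segment from `x₁` to `x₂` bounds
the subgradients by `ℓ + η` (`mul_norm_sub_sq_le_of_penalized_min`), so that a subsequence
converges weak* as `η → 0`, by reflexivity (`IsReflexiveSpace.exists_subseq_tendsto_apply`).
-/

/-! ### Ekeland's variational principle -/

/-- **Ekeland's variational principle** for a real-valued lower semicontinuous function bounded
below, with slope `c`. -/
theorem LowerSemicontinuous.exists_ekeland {E : Type*} [MetricSpace E] [CompleteSpace E]
    {F : E → ℝ} (hF : LowerSemicontinuous F) {b : ℝ} (hb : ∀ x, b ≤ F x) {c : ℝ} (hc : 0 < c)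
    (x₀ : E) :
    ∃ z, F z + c * dist z x₀ ≤ F x₀ ∧ ∀ w, F z ≤ F w + c * dist w z := by
  -- `S x` is the set of points that improve on `x` by at least `c` times their distance to `x`.
  let S : E → Set E := fun x => {w | F w + c * dist w x ≤ F x}
  have hSself : ∀ x, x ∈ S x := fun x => by simp [S]
  have hStrans : ∀ {x y w}, y ∈ S x → w ∈ S y → w ∈ S x := by
    intro x y w hy hw
    simp only [S, Set.mem_ofPred_eq] at hy hw ⊢
    nlinarith [mul_le_mul_of_nonneg_left (dist_triangle w y x) hc.le]
  have hSclosed : ∀ x, IsClosed (S x) := fun x =>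
    (hF.add (continuous_const.mul (continuous_id.dist continuous_const)).lowerSemicontinuous
      ).isClosed_preimage (F x)
  have hnext : ∀ (n : ℕ) (x : E), ∃ y ∈ S x, ∀ w ∈ S x, F y ≤ F w + (1 / 2 : ℝ) ^ n := by
    intro n x
    have hbdd : BddBelow (F '' S x) := ⟨b, by rintro _ ⟨w, -, rfl⟩; exact hb w⟩
    obtain ⟨_, ⟨y, hy, rfl⟩, hlt⟩ := exists_lt_of_csInf_lt (s := F '' S x)
      ⟨_, x, hSself x, rfl⟩ (lt_add_of_pos_right _ (show (0 : ℝ) < (1 / 2) ^ n by positivity))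
    exact ⟨y, hy, fun w hw => hlt.le.trans
      (by gcongr; exact csInf_le hbdd ⟨w, hw, rfl⟩)⟩
  choose next hnextS hnextF using hnext
  let x : ℕ → E := fun n => Nat.rec x₀ next n
  have hxsucc : ∀ n, x (n + 1) = next n (x n) := fun n => rfl
  have hxS : ∀ n m, n ≤ m → x m ∈ S (x n) := by
    intro n m hnm
    induction m, hnm using Nat.le_induction with
    | base => exact hSself _
    | succ m _ ih => exact hStrans ih (hnextS m (x m))
  have hanti : Antitone fun n => F (x n) := by
    intro n m hnm
    have := hxS n m hnm
    simp only [S, Set.mem_ofPred_eq] at this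
    nlinarith [mul_nonneg hc.le (dist_nonneg (x := x m) (y := x n))]
  have hlim := tendsto_atTop_ciInf hanti ⟨b, by rintro _ ⟨n, rfl⟩; exact hb _⟩
  set L := ⨅ n, F (x n)
  have hL : ∀ n, L ≤ F (x n) := fun n => hanti.le_of_tendsto hlim n
  have hcauchy : CauchySeq x := by
    refine cauchySeq_of_le_tendsto_0' (fun n => (F (x n) - L) / c) (fun n m hnm => ?_) ?_
    · have := hxS n m hnm
      simp only [S, Set.mem_ofPred_eq] at this
      rw [le_div_iff₀ hc, dist_comm]
      linarith [hL m]
    · simpa using (hlim.sub_const L).div_const c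
  obtain ⟨z, hz⟩ := cauchySeq_tendsto_of_complete hcauchy
  have hzS : ∀ n, z ∈ S (x n) := fun n =>
    (hSclosed _).mem_of_tendsto hz ((eventually_ge_atTop n).mono fun m hm => hxS n m hm)
  refine ⟨z, hzS 0, fun w => ?_⟩
  by_contra! hw
  have hwz : w ∈ S z := hw.le
  -- `w` competes at every stage of the construction, so `F w` cannot lie below `F z`.
  have hle : ∀ n : ℕ, F z ≤ F w + (1 / 2 : ℝ) ^ n := by
    intro n
    have h1 := hnextF n (x n) w (hStrans (hzS n) hwz)
    have h2 := hzS (n + 1)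
    simp only [S, Set.mem_ofPred_eq] at h2
    rw [← hxsucc] at h1
    nlinarith [mul_nonneg hc.le (dist_nonneg (x := z) (y := x (n + 1)))]
  have hpow : Tendsto (fun n : ℕ => F w + (1 / 2 : ℝ) ^ n) atTop (𝓝 (F w + 0)) :=
    (tendsto_pow_atTop_nhds_zero_of_lt_one (by norm_num) (by norm_num)).const_add _
  have := ge_of_tendsto' hpow hle
  nlinarith [mul_nonneg hc.le (dist_nonneg (x := w) (y := z))]

/-! ### Weak* sequential compactness in the dual of a reflexive space -/

theorem IsReflexiveSpace.exists_norming {X : Type*} [NormedAddCommGroup X] [NormedSpace ℝ X]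
    (hX : IsReflexiveSpace X) (y : StrongDual ℝ X) : ∃ x : X, ‖x‖ ≤ 1 ∧ y x = ‖y‖ := by
  obtain ⟨φ, hφ, hφy⟩ := exists_dual_vector'' ℝ y
  obtain ⟨x, rfl⟩ := hX φ
  exact ⟨x, by simpa using
    (NormedSpace.inclusionInDoubleDualLi (E := X) ℝ).norm_map x ▸ hφ, by simpa using hφy⟩

/-- Weak* sequential compactness of bounded sets in the dual of a reflexive space. The closed span
`Y` of the sequence is separable, so countably many points `p d` of `X` separate `Y`. A diagonal
subsequence converges at all `p d`. All its weak* cluster points lie in `Y`, since by reflexivity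
`Y` is weak* closed; as they agree at the `p d`, there is only one. -/
theorem IsReflexiveSpace.exists_subseq_tendsto_apply {X : Type*} [NormedAddCommGroup X]
    [NormedSpace ℝ X] (hX : IsReflexiveSpace X) {M : ℝ} (y : ℕ → StrongDual ℝ X)
    (hy : ∀ n, ‖y n‖ ≤ M) :
    ∃ (ys : StrongDual ℝ X) (φ : ℕ → ℕ), StrictMono φ ∧
      ∀ v : X, Tendsto (fun n => y (φ n) v) atTop (𝓝 (ys v)) := by
  let Y : Submodule ℝ (StrongDual ℝ X) := (Submodule.span ℝ (Set.range y)).topologicalClosure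
  have hyY : ∀ n, y n ∈ Y := fun n =>
    Submodule.le_topologicalClosure _ (Submodule.subset_span ⟨n, rfl⟩)
  obtain ⟨c, hc, hYc⟩ : TopologicalSpace.IsSeparable (Y : Set (StrongDual ℝ X)) := by
    rw [Submodule.topologicalClosure_coe]
    exact ((Set.countable_range y).isSeparable.span (R := ℝ)).closure
  have : Countable c := hc
  choose p hp hpd using fun d : c => hX.exists_norming (d : StrongDual ℝ X)
  -- The points `p d` separate the elements of `Y`.
  have hsep : ∀ w ∈ Y, (∀ d, w (p d) = 0) → w = 0 := by
    intro w hw h0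
    refine norm_le_zero_iff.1 (le_of_forall_pos_le_add fun ε hε => ?_)
    obtain ⟨d, hd, hwd⟩ := Metric.mem_closure_iff.1 (hYc hw) (ε / 2) (by positivity)
    rw [dist_eq_norm] at hwd
    have h1 : ‖d‖ ≤ ‖w - d‖ := by
      have h2 := (w - d).le_opNorm (p ⟨d, hd⟩)
      have h3 : (w - d) (p ⟨d, hd⟩) = -‖d‖ := by
        rw [sub_apply, h0, show d (p ⟨d, hd⟩) = ‖d‖ from hpd ⟨d, hd⟩, zero_sub]
      rw [h3, norm_neg, norm_norm] at h2
      exact h2.trans (mul_le_of_le_one_right (norm_nonneg _) (hp _))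
    have h4 : ‖w‖ ≤ ‖w - d‖ + ‖d‖ := by simpa using norm_add_le (w - d) d
    linarith
  have hbox : ∀ n, (fun d : c => y n (p d)) ∈ Set.univ.pi fun _ : c => Set.Icc (-M) M := by
    intro n d _
    refine abs_le.1 ?_
    exact ((y n).le_opNorm _).trans
      ((mul_le_of_le_one_right (norm_nonneg _) (hp d)).trans (hy n))
  obtain ⟨a, -, φ, hφ, hlim⟩ := (isCompact_univ_pi fun _ : c => isCompact_Icc).tendsto_subseq hbox
  have hlim' : ∀ d : c, Tendsto (fun n => y (φ n) (p d)) atTop (𝓝 (a d)) :=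
    fun d => tendsto_pi_nhds.1 hlim d
  -- Along any ultrafilter the bounded sequence has a weak* limit, and that limit lies in `Y`.
  have hultra : ∀ g : Ultrafilter ℕ, (g : Filter ℕ) ≤ atTop → ∃ w ∈ Y, (∀ d, w (p d) = a d) ∧
      ∀ v, Tendsto (fun n => y (φ n) v) g (𝓝 (w v)) := by
    intro g hg
    obtain ⟨w, -, hw⟩ := (WeakDual.isCompact_closedBall (𝕜 := ℝ) (0 : StrongDual ℝ X) M
      ).ultrafilter_le_nhds (g.map fun n => StrongDual.toWeakDual (y (φ n))) (by
        refine le_principal_iff.2 (mem_map.2 (Eventually.of_forall fun n => ?_))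
        simpa using hy (φ n))
    have hwv : ∀ v, Tendsto (fun n => y (φ n) v) g (𝓝 (w v)) := fun v =>
      ((WeakDual.eval_continuous v).tendsto w).comp hw
    refine ⟨WeakDual.toStrongDual w, ?_, fun d => ?_, hwv⟩
    · by_contra hwY
      obtain ⟨ψ, s, hψ, hψw⟩ := geometric_hahn_banach_closed_point Y.convex
        (Submodule.isClosed_topologicalClosure _) hwY
      obtain ⟨v, rfl⟩ := hX ψ
      have := le_of_tendsto' (hwv v) (fun n => (hψ _ (hyY (φ n))).le)
      exact absurd hψw (not_lt.2 this)
    · exact tendsto_nhds_unique (hwv (p d)) ((hlim' d).mono_left hg)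
  obtain ⟨w, hwY, hwa, -⟩ := hultra (hyperfilter ℕ) (Nat.hyperfilter_le_atTop)
  refine ⟨w, φ, hφ, fun v => tendsto_iff_ultrafilter _ _ _ |>.2 fun g hg => ?_⟩
  obtain ⟨w', hwY', hwa', hv⟩ := hultra g hg
  have : w' - w = 0 := hsep _ (Y.sub_mem hwY' hwY) fun d => by simp [hwa, hwa']
  rw [← sub_eq_zero.1 this]
  exact hv v

/-! ### The duality mapping and relative subgradients -/

section DualityMap

variable {X : Type*} [NormedAddCommGroup X] [NormedSpace ℝ X]

/-- If the norm is differentiable off `0`, then `‖·‖ ^ 2 / 2` is differentiable everywhere, with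
derivative in the duality mapping. -/
theorem exists_mem_dualityMap_hasFDerivAt
    (hdiff : ∀ x : X, x ≠ 0 → DifferentiableAt ℝ (fun y : X => ‖y‖) x) (v : X) :
    ∃ j ∈ dualityMap v, HasFDerivAt (fun y : X => ‖y‖ ^ 2 / 2) j v := by
  rcases eq_or_ne v 0 with rfl | hv
  · refine ⟨0, by simp [dualityMap], ?_⟩
    rw [hasFDerivAt_iff_isLittleO_nhds_zero]
    have h : (fun y : X => ‖y‖ ^ 2) =o[𝓝 0] fun y : X => y := by
      simpa using (Asymptotics.isLittleO_norm_pow_id (E' := X) one_lt_two)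
    simpa [div_eq_inv_mul] using h.const_mul_left (2⁻¹ : ℝ)
  · have : Nontrivial X := ⟨v, 0, hv⟩
    have hd := hdiff v hv
    refine ⟨‖v‖ • fderiv ℝ (‖·‖) v, ⟨?_, ?_⟩, ?_⟩
    · simp only [smul_apply, smul_eq_mul, hd.fderiv_norm_self]
      ring
    · rw [norm_smul, norm_norm, norm_fderiv_norm hd, mul_one]
    · have h := (hd.hasFDerivAt.pow 2).const_mul (1 / 2 : ℝ)
      refine (h.congr_fderiv ?_).congr_of_eventuallyEq (.of_forall fun y => ?_)
      · ext w
        simp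
        ring
      · simp only []
        ring

theorem smul_mem_dualityMap {v : X} {j : StrongDual ℝ X} (hj : j ∈ dualityMap v) (a : ℝ) :
    a • j ∈ dualityMap (a • v) := by
  obtain ⟨h1, h2⟩ := hj
  refine ⟨?_, by rw [norm_smul, norm_smul, mul_pow, mul_pow, h2]⟩
  simp only [smul_apply, map_smul, smul_eq_mul, h1, norm_smul, mul_pow,
    Real.norm_eq_abs, sq_abs]
  ring

theorem Convex.smul_sub_mem_bouligandCone {C : Set X} (hC : Convex ℝ C) {x y : X} (hx : x ∈ C)
    (hy : y ∈ C) {k : ℝ} (hk : 0 < k) : k • (y - x) ∈ bouligandCone x C := by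
  refine ⟨fun n => 1 / (n + 1 : ℝ) / k, fun _ => k • (y - x), fun n => by positivity, ?_,
    tendsto_const_nhds, fun n => ?_⟩
  · simpa using (tendsto_one_div_add_atTop_nhds_zero_nat (𝕜 := ℝ)).div_const k
  · rw [smul_smul, div_mul_cancel₀ _ hk.ne']
    refine hC.add_smul_sub_mem hx hy ⟨by positivity, ?_⟩
    rw [div_le_one (by positivity)]
    linarith [n.cast_nonneg (α := ℝ)]

/-- If `f + q + ε * ‖· - x‖` has a local minimum over `C` at `x` and
`q` is differentiable at `x`, then `-q'(x)` is an `ε`-regular subgradient relative to `C` as soon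
as it lies in `J(T(x, C))`. The values of `f` enter only through real upper bounds `r`, so `f` may
be infinite near `x`. -/
theorem mem_relRegSubdiff_of_hasFDerivAt {f : X → EReal} {C : Set X} {x : X}
    {xs : StrongDual ℝ X} {q : X → ℝ} {ε : ℝ} (hx : x ∈ C) (hfin : FiniteAt f x)
    (hT : xs ∈ dualTangent x C) (hq : HasFDerivAt q (-xs) x) (hε : 0 ≤ ε)
    (h : ∀ᶠ u in 𝓝 x, u ∈ C → ∀ r : ℝ, f u ≤ r →
      (f x).toReal + q x ≤ r + q u + ε * ‖u - x‖) :
    xs ∈ relRegSubdiff ε C f x := by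
  have hfx : restrictTo f C x = f x := if_pos hx
  refine ⟨hx, hfin, ⟨?_, ?_⟩, hT⟩
  · simpa only [FiniteAt, hfx] using hfin
  · rw [hfx]
    refine EReal.le_of_forall_lt_iff_le.1 fun a ha => ?_
    have ha' : ε < a := EReal.coe_lt_coe_iff.1 ha
    refine limsup_le_of_le (h := ?_)
    have hlin := hq.isLittleO.def (sub_pos.2 ha')
    have hfst : Tendsto Prod.fst (𝓝[epigraph (restrictTo f C) \ {(x, (f x).toReal)}]
        (x, (f x).toReal)) (𝓝 x) :=
      (continuous_fst.tendsto (x, (f x).toReal)).mono_left nhdsWithin_le_nhds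
    filter_upwards [hfst.eventually h, hfst.eventually hlin, self_mem_nhdsWithin]
      with w hw1 hw2 hw3
    have hepi : restrictTo f C w.1 ≤ (w.2 : EReal) := hw3.1
    have hwC : w.1 ∈ C := by
      by_contra hc
      simp [restrictTo, hc] at hepi
    rw [restrictTo, if_pos hwC] at hepi
    have h1 := hw1 hwC w.2 hepi
    rw [Real.norm_eq_abs] at hw2
    have h2 := (abs_le.1 hw2).2
    simp only [neg_apply] at h2
    refine EReal.coe_le_coe_iff.2 (div_le_of_le_mul₀ (by positivity) (hε.trans ha'.le) ?_)
    have h3 : 0 ≤ a * |w.2 - (f x).toReal| :=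
      mul_nonneg (hε.trans ha'.le) (abs_nonneg _)
    simp only [mul_add]
    nlinarith

end DualityMap

/-! ### Decoupling the two functions by a quadratic penalty -/

/-- Near a minimizer `x₀` of `g + h` over `B`, Ekeland's principle applied to
`(x, u) ↦ g x + h u + k * ‖x - u‖ ^ 2 / 2` on `B × B`, starting at `(x₀, x₀)`, gives a pair that is
minimal in each variable separately up to slope `c`. As `g` is Lipschitz on `B`, for large `k` the
pair `(x₀, x₀)` is already almost minimal, which keeps the new pair within `r` of `x₀`. -/
theorem exists_penalized_almost_minimizer {X : Type*} [NormedAddCommGroup X] [CompleteSpace X]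
    {B : Set X} (hB : IsClosed B) {g h : X → ℝ} {ℓ : ℝ}
    (hg : ∀ u ∈ B, ∀ v ∈ B, |g u - g v| ≤ ℓ * ‖u - v‖) (hh : LowerSemicontinuousOn h B)
    {x₀ : X} (hx₀ : x₀ ∈ B) (hmin : ∀ u ∈ B, g x₀ + h x₀ ≤ g u + h u)
    {c : ℝ} (hc : 0 < c) {r : ℝ} (hr : 0 < r) :
    ∃ k : ℝ, 0 < k ∧ ∃ x₁ ∈ B, ∃ x₂ ∈ B, ‖x₁ - x₀‖ ≤ r ∧ ‖x₂ - x₀‖ ≤ r ∧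
      g x₁ + h x₂ ≤ g x₀ + h x₀ ∧
      (∀ x ∈ B, g x₁ + k * (‖x₁ - x₂‖ ^ 2 / 2) ≤
        g x + k * (‖x - x₂‖ ^ 2 / 2) + c * ‖x - x₁‖) ∧
      ∀ u ∈ B, h x₂ + k * (‖x₁ - x₂‖ ^ 2 / 2) ≤
        h u + k * (‖x₁ - u‖ ^ 2 / 2) + c * ‖u - x₂‖ := by
  have := hB.completeSpace_coe
  -- With this `k` the penalized function drops below its value at `(x₀, x₀)` by at most `c * r`.
  let k : ℝ := ℓ ^ 2 / (2 * (c * r)) + 1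
  have hk : 0 < k := by positivity
  have hkℓ : ℓ ^ 2 ≤ 2 * k * (c * r) := by
    have : 2 * k * (c * r) = ℓ ^ 2 + 2 * (c * r) := by
      simp only [k]; field_simp
    rw [this]; linarith [mul_pos hc hr]
  let F : B × B → ℝ := fun p => h p.2 + (g p.1 + k * (‖(p.1 : X) - p.2‖ ^ 2 / 2))
  have hgcont : Continuous fun p : B × B => g p.1 := by
    have : ContinuousOn g B := by
      refine (LipschitzOnWith.of_dist_le_mul (K := ℓ.toNNReal) fun u hu v hv => ?_).continuousOn
      rw [Real.dist_eq, dist_eq_norm]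
      exact (hg u hu v hv).trans (by gcongr; exact Real.le_coe_toNNReal ℓ)
    exact (continuousOn_iff_continuous_domRestrict.1 this).comp continuous_fst
  have hhlsc : LowerSemicontinuous fun p : B × B => h p.2 :=
    (lowerSemicontinuous_restrict_iff.2 hh).comp continuous_snd
  have hF : LowerSemicontinuous F :=
    hhlsc.add (hgcont.add (by fun_prop)).lowerSemicontinuous
  have hFb : ∀ p, g x₀ + h x₀ - c * r ≤ F p := by
    rintro ⟨⟨x, hx⟩, ⟨u, hu⟩⟩
    have h1 := (abs_le.1 (hg x hx u hu)).1
    have h2 := hmin u hu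
    have h3 : ℓ * ‖x - u‖ - k * (‖x - u‖ ^ 2 / 2) ≤ c * r := by
      refine le_of_mul_le_mul_left ?_ (mul_pos two_pos hk)
      nlinarith [sq_nonneg (k * ‖x - u‖ - ℓ)]
    simp only [F]
    linarith
  obtain ⟨⟨⟨x₁, hx₁⟩, ⟨x₂, hx₂⟩⟩, hz, hzw⟩ :=
    hF.exists_ekeland hFb hc (⟨x₀, hx₀⟩, ⟨x₀, hx₀⟩)
  have hFz := hFb (⟨x₁, hx₁⟩, ⟨x₂, hx₂⟩)
  simp only [F, Prod.dist_eq, Subtype.dist_eq, dist_eq_norm, sub_self, norm_zero] at hz hzw hFz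
  have hmax : max ‖x₁ - x₀‖ ‖x₂ - x₀‖ ≤ r := by
    refine le_of_mul_le_mul_left ?_ hc
    linarith
  have hpos : 0 ≤ k * (‖x₁ - x₂‖ ^ 2 / 2) := by positivity
  refine ⟨k, hk, x₁, hx₁, x₂, hx₂, (le_max_left _ _).trans hmax, (le_max_right _ _).trans hmax,
    ?_, fun x hx => ?_, fun u hu => ?_⟩
  · have : 0 ≤ c * max ‖x₁ - x₀‖ ‖x₂ - x₀‖ := by positivity
    linarith
  · have := hzw (⟨x, hx⟩, ⟨x₂, hx₂⟩)
    simp only [sub_self, norm_zero, norm_nonneg, max_eq_left] at this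
    linarith
  · have := hzw (⟨x₁, hx₁⟩, ⟨u, hu⟩)
    simp only [sub_self, norm_zero, norm_nonneg, max_eq_right] at this
    linarith

/-- Comparing `x₁` with points of the segment from `x₁` to `x₂`, which stays in the convex set `B`,
bounds the slope `k * ‖x₁ - x₂‖` of the penalty by `ℓ + c`, uniformly in `k`. The inequality is
stated multiplied by `‖x₁ - x₂‖`, so that `x₁ = x₂` needs no separate treatment. -/
theorem mul_norm_sub_sq_le_of_penalized_min {X : Type*} [NormedAddCommGroup X] [NormedSpace ℝ X]
    {B : Set X} (hB : Convex ℝ B) {g : X → ℝ} {ℓ c k : ℝ}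
    (hg : ∀ u ∈ B, ∀ v ∈ B, |g u - g v| ≤ ℓ * ‖u - v‖) {x₁ x₂ : X} (hx₁ : x₁ ∈ B) (hx₂ : x₂ ∈ B)
    (hmin : ∀ x ∈ B, g x₁ + k * (‖x₁ - x₂‖ ^ 2 / 2) ≤
        g x + k * (‖x - x₂‖ ^ 2 / 2) + c * ‖x - x₁‖) :
    k * ‖x₁ - x₂‖ ^ 2 ≤ (ℓ + c) * ‖x₁ - x₂‖ := by
  set s := ‖x₁ - x₂‖ with hs
  have hstep : ∀ t : ℝ, 0 < t → t ≤ 1 → k * s ^ 2 * (1 - t / 2) ≤ (ℓ + c) * s := by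
    intro t ht ht1
    have hxt : x₁ + t • (x₂ - x₁) ∈ B := hB.add_smul_sub_mem hx₁ hx₂ ⟨ht.le, ht1⟩
    have h1 := hmin _ hxt
    have h2 := (abs_le.1 (hg _ hxt _ hx₁)).2
    have e1 : ‖x₁ + t • (x₂ - x₁) - x₁‖ = t * s := by
      rw [add_sub_cancel_left, norm_smul, Real.norm_of_nonneg ht.le, norm_sub_rev]
    have e2 : ‖x₁ + t • (x₂ - x₁) - x₂‖ = (1 - t) * s := by
      rw [show x₁ + t • (x₂ - x₁) - x₂ = (1 - t) • (x₁ - x₂) by module, norm_smul,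
        Real.norm_of_nonneg (sub_nonneg.2 ht1)]
    rw [e1] at h1 h2
    rw [e2] at h1
    refine le_of_mul_le_mul_left ?_ ht
    nlinarith
  have hlim : Tendsto (fun t : ℝ => k * s ^ 2 * (1 - t / 2)) (𝓝[>] 0)
      (𝓝 (k * s ^ 2 * (1 - 0 / 2))) :=
    (Continuous.tendsto (by fun_prop) 0).mono_left nhdsWithin_le_nhds
  have := le_of_tendsto hlim (b := (ℓ + c) * s) (by
    filter_upwards [Ioc_mem_nhdsGT one_pos] with t ht using hstep t ht.1 ht.2)
  simpa using this

/-! ### The fuzzy and the limiting sum rule -/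

/-- The fuzzy sum rule with exactly opposite subgradients `xs`, `-xs`, with the tolerance `η` itself
as `ε`, and with a norm bound on `xs` from which the limiting sum rule follows by weak*
compactness. -/
theorem exists_fuzzy_relRegSubdiff {X : Type*} [NormedAddCommGroup X] [NormedSpace ℝ X]
    [CompleteSpace X]
    (hdiff : ∀ x : X, x ≠ 0 → DifferentiableAt ℝ (fun y : X => ‖y‖) x)
    {C : Set X} (hCclosed : IsClosed C) (hCconvex : Convex ℝ C)
    {f₁ f₂ : X → EReal} {xbar : X} (hxbar : xbar ∈ C) {ℓ : ℝ} (hℓ : 0 ≤ ℓ)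
    (hf₁ : LocLipschitzRel f₁ C xbar ℓ) (hf₂ : LscRelAround f₂ C xbar)
    (hf₂fin : FiniteAt f₂ xbar) (hmin : IsLocalMinOn (fun x => f₁ x + f₂ x) C xbar) :
    ∃ η₀ : ℝ, 0 < η₀ ∧ ∀ η : ℝ, 0 < η → η < η₀ →
      ∃ x₁ ∈ Metric.closedBall xbar η ∩ C, ∃ x₂ ∈ Metric.closedBall xbar η ∩ C,
        (FiniteAt f₁ x₁ ∧ |(f₁ x₁).toReal - (f₁ xbar).toReal| ≤ η) ∧
        (FiniteAt f₂ x₂ ∧ |(f₂ x₂).toReal - (f₂ xbar).toReal| ≤ η) ∧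
        ∃ xs : StrongDual ℝ X, ‖xs‖ ≤ ℓ + η ∧
          xs ∈ relRegSubdiff η C f₁ x₁ ∧ -xs ∈ relRegSubdiff η C f₂ x₂ := by
  obtain ⟨U, hU, hUfin, hUlip⟩ := hf₁
  obtain ⟨V, hV, hVlsc⟩ := hf₂
  obtain ⟨W, hW, hWmin⟩ := eventually_iff_exists_mem.1 (eventually_nhdsWithin_iff.1 hmin)
  obtain ⟨δ, hδ, hball⟩ := Metric.nhds_basis_closedBall.mem_iff.1 (inter_mem hU (inter_mem hV hW))
  let B : Set X := Metric.closedBall xbar δ ∩ C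
  have hBclosed : IsClosed B := Metric.isClosed_closedBall.inter hCclosed
  have hBconvex : Convex ℝ B := (convex_closedBall xbar δ).inter hCconvex
  have hxB : xbar ∈ B := ⟨Metric.mem_closedBall_self hδ.le, hxbar⟩
  have hBU : ∀ u ∈ B, u ∈ U ∩ C := fun u hu => ⟨(hball hu.1).1, hu.2⟩
  let g : X → ℝ := fun u => (f₁ u).toReal
  have hgf : ∀ u ∈ B, f₁ u = (g u : EReal) := fun u hu =>
    (EReal.coe_toReal (hUfin u (hBU u hu)).1 (hUfin u (hBU u hu)).2).symm
  have hg : ∀ u ∈ B, ∀ v ∈ B, |g u - g v| ≤ ℓ * ‖u - v‖ := fun u hu v hv =>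
    hUlip u (hBU u hu) v (hBU v hv)
  have hf₂x : f₂ xbar = ((f₂ xbar).toReal : EReal) :=
    (EReal.coe_toReal hf₂fin.1 hf₂fin.2).symm
  have hsum : ∀ u ∈ B, f₁ xbar + f₂ xbar ≤ f₁ u + f₂ u := fun u hu =>
    hWmin u (hball hu.1).2.2 hu.2
  have hbot : ∀ u ∈ B, f₂ u ≠ ⊥ := by
    intro u hu h
    have := hsum u hu
    rw [h, EReal.add_bot, hgf xbar hxB, hf₂x, ← EReal.coe_add, le_bot_iff] at this
    exact EReal.coe_ne_bot _ this
  -- Truncating `f₂` at a level that is too high to matter for the minimum makes it real-valued.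
  let M : ℝ := (f₂ xbar).toReal + ℓ * δ + 1
  let h : X → ℝ := fun u => (min (f₂ u) (M : EReal)).toReal
  have hhf : ∀ u ∈ B, (h u : EReal) = min (f₂ u) (M : EReal) := by
    intro u hu
    refine EReal.coe_toReal (ne_top_of_le_ne_top (EReal.coe_ne_top M) (min_le_right _ _)) ?_
    rw [← bot_lt_iff_ne_bot, lt_min_iff]
    exact ⟨bot_lt_iff_ne_bot.2 (hbot u hu), EReal.bot_lt_coe M⟩
  have hhle : ∀ u ∈ B, ∀ r : ℝ, f₂ u ≤ r → h u ≤ r := fun u hu r hr =>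
    EReal.coe_le_coe_iff.1 ((hhf u hu).trans_le ((min_le_left _ _).trans hr))
  have hfh : ∀ u ∈ B, h u < M → f₂ u = (h u : EReal) := by
    intro u hu hlt
    have h1 := hhf u hu
    rcases min_choice (f₂ u) (M : EReal) with h2 | h2
    · rw [h1, h2]
    · rw [h2] at h1
      exact absurd (EReal.coe_eq_coe_iff.1 h1) hlt.ne
  have hhx : h xbar = (f₂ xbar).toReal := by
    have : f₂ xbar ≤ (M : EReal) := by
      rw [hf₂x, EReal.coe_le_coe_iff]
      simp only [M]
      linarith [mul_nonneg hℓ hδ.le]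
    simp only [h, min_eq_left this]
  have hhlsc : LowerSemicontinuousOn h B := by
    intro u hu y hy
    have hy' : (y : EReal) < min (f₂ u) (M : EReal) := by
      rw [← hhf u hu]
      exact EReal.coe_lt_coe_iff.2 hy
    rw [lt_min_iff] at hy'
    filter_upwards [(hVlsc u ⟨(hball hu.1).2.1, hu.2⟩).mono Set.inter_subset_right _ hy'.1,
      self_mem_nhdsWithin] with w hw hwB
    exact EReal.coe_lt_coe_iff.1 ((lt_min hw hy'.2).trans_eq (hhf w hwB).symm)
  have hmin' : ∀ u ∈ B, g xbar + h xbar ≤ g u + h u := by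
    intro u hu
    have hcase : h u = M ∨ f₂ u = (h u : EReal) := by
      rcases min_choice (f₂ u) (M : EReal) with h2 | h2
      · exact .inr (by rw [hhf u hu, h2])
      · exact .inl (EReal.coe_eq_coe_iff.1 ((hhf u hu).trans h2))
    rcases hcase with h2 | h2
    · have h3 := (abs_le.1 (hg u hu xbar hxB)).1
      have h4 : ‖u - xbar‖ ≤ δ := mem_closedBall_iff_norm.1 hu.1
      have h5 := mul_le_mul_of_nonneg_left h4 hℓ
      rw [h2, hhx]
      simp only [M]
      linarith
    · have h3 := hsum u hu
      rw [hgf u hu, hgf xbar hxB, h2, hf₂x, ← hhx] at h3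
      exact_mod_cast h3
  refine ⟨δ, hδ, fun η hη hηδ => ?_⟩
  -- Within distance `r` of `xbar` the value of `f₁` changes by at most `η`. So does the value of
  -- `f₂` at `x₂`: from below by minimality of `xbar`, from above by the choice of `(x₁, x₂)`.
  let r : ℝ := η / (ℓ + 1)
  have hr : 0 < r := by positivity
  have hrη : r ≤ η := div_le_self hη.le (by linarith)
  have hℓr : ℓ * r ≤ η := by
    have : (ℓ + 1) * r = η := by simp only [r]; field_simp
    linarith
  obtain ⟨k, hk, x₁, hx₁, x₂, hx₂, hd₁, hd₂, hval, hm₁, hm₂⟩ :=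
    exists_penalized_almost_minimizer hBclosed hg hhlsc hxB hmin' hη hr
  have hgd : ∀ x ∈ B, ‖x - xbar‖ ≤ r → |g x - g xbar| ≤ ℓ * r := fun x hx hxr =>
    (hg x hx xbar hxB).trans (mul_le_mul_of_nonneg_left hxr hℓ)
  have hg₁ := abs_le.1 (hgd x₁ hx₁ hd₁)
  have hg₂ := abs_le.1 (hgd x₂ hx₂ hd₂)
  have hh₂ : |h x₂ - h xbar| ≤ ℓ * r := by
    have := hmin' x₂ hx₂
    exact abs_le.2 ⟨by linarith, by linarith⟩
  have hf₂x₂ : f₂ x₂ = (h x₂ : EReal) := by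
    refine hfh x₂ hx₂ ?_
    have := (abs_le.1 hh₂).2
    have : ℓ * r ≤ ℓ * δ := mul_le_mul_of_nonneg_left (hrη.trans hηδ.le) hℓ
    simp only [M]
    linarith
  have hfin₁ : FiniteAt f₁ x₁ := hUfin x₁ (hBU x₁ hx₁)
  have hfin₂ : FiniteAt f₂ x₂ := by
    rw [FiniteAt, hf₂x₂]
    exact ⟨EReal.coe_ne_top _, EReal.coe_ne_bot _⟩
  have hnear : ∀ x, ‖x - xbar‖ ≤ r → ∀ᶠ u in 𝓝 x, u ∈ C → u ∈ B := by
    intro x hx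
    have : x ∈ Metric.ball xbar δ := by
      rw [mem_ball_iff_norm]
      exact (hx.trans hrη).trans_lt hηδ
    filter_upwards [Metric.isOpen_ball.mem_nhds this] with u hu huC
    exact ⟨Metric.ball_subset_closedBall hu, huC⟩
  obtain ⟨j, hj, hjd⟩ := exists_mem_dualityMap_hasFDerivAt hdiff (x₁ - x₂)
  refine ⟨x₁, ⟨mem_closedBall_iff_norm.2 (hd₁.trans hrη), hx₁.2⟩, x₂,
    ⟨mem_closedBall_iff_norm.2 (hd₂.trans hrη), hx₂.2⟩,
    ⟨hfin₁, (hgd x₁ hx₁ hd₁).trans hℓr⟩, ⟨hfin₂, ?_⟩, -(k • j), ?_, ?_, ?_⟩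
  · rw [hf₂x₂, EReal.toReal_coe, ← hhx]
    exact hh₂.trans hℓr
  · have hbound := mul_norm_sub_sq_le_of_penalized_min hBconvex hg hx₁ hx₂ hm₁
    have hjn : ‖j‖ = ‖x₁ - x₂‖ :=
      (pow_left_inj₀ (norm_nonneg _) (norm_nonneg _) two_ne_zero).1 hj.2
    rw [norm_neg, norm_smul, Real.norm_of_nonneg hk.le, hjn]
    rcases (norm_nonneg (x₁ - x₂)).eq_or_lt with h0 | h0
    · rw [← h0]
      linarith
    · refine le_of_mul_le_mul_right ?_ h0
      linarith
  -- By convexity of `C` the direction `k • (x₂ - x₁)`, which `J` maps to `-(k • j)`, is tangent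
  -- to `C` at `x₁`; its negative is tangent at `x₂`.
  · refine mem_relRegSubdiff_of_hasFDerivAt (q := fun x => k * (‖x - x₂‖ ^ 2 / 2)) hx₁.2 hfin₁ ?_
      ?_ hη.le ?_
    · refine Set.mem_biUnion (hCconvex.smul_sub_mem_bouligandCone hx₁.2 hx₂.2 hk) ?_
      have := smul_mem_dualityMap hj (-k)
      rwa [neg_smul k (x₁ - x₂), ← smul_neg, neg_sub, neg_smul k j] at this
    · rw [neg_neg]
      exact (hjd.comp x₁ ((hasFDerivAt_id x₁).sub_const x₂)).const_mul k
    · filter_upwards [hnear x₁ hd₁] with u hu huC r hr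
      have hgr : g u ≤ r := EReal.coe_le_coe_iff.1 ((hgf u (hu huC)).symm.trans_le hr)
      have := hm₁ u (hu huC)
      simp only [g] at this hgr ⊢
      linarith
  · rw [neg_neg]
    refine mem_relRegSubdiff_of_hasFDerivAt (q := fun x => k * (‖x₁ - x‖ ^ 2 / 2)) hx₂.2 hfin₂ ?_
      ?_ hη.le ?_
    · exact Set.mem_biUnion (hCconvex.smul_sub_mem_bouligandCone hx₂.2 hx₁.2 hk)
        (smul_mem_dualityMap hj k)
    · refine ((hjd.comp x₂ ((hasFDerivAt_id x₂).const_sub x₁)).const_mul k).congr_fderiv ?_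
      ext w
      simp
    · filter_upwards [hnear x₂ hd₂] with u hu huC r hr
      have hhr := hhle u (hu huC) r hr
      have := hm₂ u (hu huC)
      rw [hf₂x₂, EReal.toReal_coe]
      linarith

theorem tendsto_of_abs_toReal_sub_le {ι : Type*} {l : Filter ι} {a : ι → EReal} {b : EReal}
    (hb : b ≠ ⊤ ∧ b ≠ ⊥) {e : ι → ℝ} (he : Tendsto e l (𝓝 0))
    (ha : ∀ i, (a i ≠ ⊤ ∧ a i ≠ ⊥) ∧ |(a i).toReal - b.toReal| ≤ e i) : Tendsto a l (𝓝 b) := by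
  have h1 : Tendsto (fun i => (a i).toReal) l (𝓝 b.toReal) :=
    tendsto_iff_norm_sub_tendsto_zero.2
      (squeeze_zero (fun i => norm_nonneg _) (fun i => (ha i).2) he)
  have h2 := EReal.tendsto_coe.2 h1
  simpa only [EReal.coe_toReal hb.1 hb.2, fun i => EReal.coe_toReal (ha i).1.1 (ha i).1.2] using h2

theorem theorem4p1 {X : Type*} [NormedAddCommGroup X] [NormedSpace ℝ X] [CompleteSpace X]
    (hrefl : IsReflexiveSpace X)
    (hLUC : IsLocallyUniformlyConvex X)
    (hLUCdual : IsLocallyUniformlyConvex (StrongDual ℝ X))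
    (hdiff : ∀ x : X, x ≠ 0 → DifferentiableAt ℝ (fun y : X => ‖y‖) x)
    (C : Set X) (hCclosed : IsClosed C) (hCconvex : Convex ℝ C)
    (f₁ f₂ : X → EReal) (xbar : X) (hxbar : xbar ∈ C)
    (ℓ : ℝ) (hℓ : 0 ≤ ℓ)
    (hf₁ : LocLipschitzRel f₁ C xbar ℓ)
    (hf₂ : LscRelAround f₂ C xbar) (hf₂fin : FiniteAt f₂ xbar)
    (hmin : IsLocalMinOn (fun x => f₁ x + f₂ x) C xbar) :
    (∃ η₀ : ℝ, 0 < η₀ ∧ ∀ η : ℝ, 0 < η → η < η₀ →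
      ∃ x₁ ∈ Metric.closedBall xbar η ∩ C, ∃ x₂ ∈ Metric.closedBall xbar η ∩ C,
        (FiniteAt f₁ x₁ ∧ |(f₁ x₁).toReal - (f₁ xbar).toReal| ≤ η) ∧
        (FiniteAt f₂ x₂ ∧ |(f₂ x₂).toReal - (f₂ xbar).toReal| ≤ η) ∧
        ∃ ηt ∈ Set.Ioo (0 : ℝ) (4 * η * (ℓ + 1)),
          (0 : StrongDual ℝ X) ∈ relRegSubdiff ηt C f₁ x₁ + relRegSubdiff ηt C f₂ x₂) ∧
    (0 : StrongDual ℝ X) ∈ relLimSubdiff C f₁ xbar + relLimSubdiff C f₂ xbar := by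
  have hf₁fin : FiniteAt f₁ xbar := by
    obtain ⟨U, hU, hfin, -⟩ := hf₁
    exact hfin xbar ⟨mem_of_mem_nhds hU, hxbar⟩
  obtain ⟨η₀, hη₀, H⟩ :=
    exists_fuzzy_relRegSubdiff hdiff hCclosed hCconvex hxbar hℓ hf₁ hf₂ hf₂fin hmin
  refine ⟨⟨η₀, hη₀, fun η hη hηη₀ => ?_⟩, ?_⟩
  · obtain ⟨x₁, hx₁, x₂, hx₂, h₁, h₂, xs, -, hs₁, hs₂⟩ := H η hη hηη₀
    exact ⟨x₁, hx₁, x₂, hx₂, h₁, h₂, η, ⟨hη, by nlinarith [mul_nonneg hη.le hℓ]⟩,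
      Set.mem_add.2 ⟨xs, hs₁, -xs, hs₂, add_neg_cancel xs⟩⟩
  let e : ℕ → ℝ := fun n => η₀ / 2 * (1 / (n + 1 : ℝ))
  have he0 : ∀ n, 0 < e n := fun n => by positivity
  have hele : ∀ n, e n ≤ η₀ / 2 := fun n =>
    mul_le_of_le_one_right (by positivity) (by
      rw [div_le_one (by positivity)]
      linarith [n.cast_nonneg (α := ℝ)])
  have heanti : Antitone e := fun m n hmn =>
    mul_le_mul_of_nonneg_left (Nat.one_div_le_one_div hmn) (by positivity)
  have helim : Tendsto e atTop (𝓝 0) := by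
    simpa only [mul_zero] using
      (tendsto_one_div_add_atTop_nhds_zero_nat (𝕜 := ℝ)).const_mul (η₀ / 2)
  choose x₁ hx₁ x₂ hx₂ h₁ h₂ xs hxs hs₁ hs₂ using fun n =>
    H (e n) (he0 n) ((hele n).trans_lt (half_lt_self hη₀))
  obtain ⟨ys, φ, hφ, hlim⟩ := hrefl.exists_subseq_tendsto_apply (M := ℓ + η₀ / 2) xs
    fun n => (hxs n).trans (by linarith [hele n])
  have hxlim : ∀ x : ℕ → X, (∀ n, x n ∈ Metric.closedBall xbar (e n) ∩ C) →
      Tendsto x atTop (𝓝 xbar) := fun x hx =>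
    tendsto_iff_dist_tendsto_zero.2
      (squeeze_zero (fun n => dist_nonneg) (fun n => (hx n).1) helim)
  have hφlim := hφ.tendsto_atTop
  refine Set.mem_add.2 ⟨ys, ⟨hxbar, hf₁fin, e ∘ φ, x₁ ∘ φ, xs ∘ φ,
      heanti.comp_monotone hφ.monotone, fun k => he0 _, helim.comp hφlim, fun k => (hx₁ _).2,
      (hxlim x₁ hx₁).comp hφlim, (tendsto_of_abs_toReal_sub_le hf₁fin helim h₁).comp hφlim,
      hlim, fun k => hs₁ _⟩,
    -ys, ⟨hxbar, hf₂fin, e ∘ φ, x₂ ∘ φ, fun k => -xs (φ k),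
      heanti.comp_monotone hφ.monotone, fun k => he0 _, helim.comp hφlim, fun k => (hx₂ _).2,
      (hxlim x₂ hx₂).comp hφlim, (tendsto_of_abs_toReal_sub_le hf₂fin helim h₂).comp hφlim,
      fun v => (hlim v).neg, fun k => hs₂ _⟩, add_neg_cancel ys⟩
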